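/- Let $K$ be a compact Hausdorff space and let $X$ be a complex Banach space endowed with a locally convex Hausdorff vector space topology $\tau$ compatible to a dual pair, i.e. either $(X,\tau)^*=X^*$, or $(X,\tau)^*=X_*$ for a predual $X_*$ of $X$ (a Banach space whose dual is isometrically isomorphic to $X$, acting on $X$ by evaluation). Let $C(K,(X,\tau))$ be the space of all continuous functions $f:K\to(X,\tau)$ with the norm $\|f\|=\sup_{t\in K}\|f(t)\|_X$. Let $A(K,(X,\tau))$ be an $(X,\tau)$-valued function space over a uniform algebra, that is, a closed linear subspace of $C(K,(X,\tau))$ such that (i) its base algebra $A:=\{y^*\circ f : f\in A(K,(X,\tau)),\ y^*\in (X,\tau)^*\}$ is a uniform algebra on $K$ (a closed subalgebra of $C(K)=C(K,\mathbb C)$ that contains the constants and separates the points of $K$), and (ii) $\varphi f\in A(K,(X,\tau))$ for all $\varphi\in A$ and $f\in A(K,(X,\tau))$, where $(\varphi f)(t)=\varphi(t)f(t)$. If $A$ is infinite dimensional, then $A(K,(X,\tau))$ has the diameter two property: every nonempty relatively weakly open subset of its closed unit ball has diameter $2$. -/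

import Mathlib

open Set Topology

universe u v

/-- The dual `X^*` for the norm topology, as a set of linear functionals. -/
def normDual (X : Type u) [NormedAddCommGroup X] [NormedSpace ℂ X] : Set (X →ₗ[ℂ] ℂ) :=
  {g | Continuous g}

/-- The functionals on `X = Y^*` (identified through `Φ`) given by evaluation at points of `Y`. -/
def predualFunctionals {X Y : Type u} [NormedAddCommGroup X] [NormedSpace ℂ X]
    [NormedAddCommGroup Y] [NormedSpace ℂ Y] (Φ : X ≃ₗᵢ[ℂ] StrongDual ℂ Y) : Set (X →ₗ[ℂ] ℂ) :=
  {g | ∃ y : Y, ∀ x : X, g x = Φ x y}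

/-- A locally convex Hausdorff vector space topology `τ` on a complex normed space `X` (besides the
norm topology) that is compatible to a dual pair: the `τ`-continuous linear functionals are
either exactly the norm-continuous ones, `(X, τ)^* = X^*`, or exactly the evaluations at the points
of a Banach space `Y` whose dual is isometrically `X`, that is `(X, τ)^* = X_*` for a
predual `X_*` of `X`. -/
structure CompatibleTopology (X : Type u) [NormedAddCommGroup X] [NormedSpace ℂ X] where
  /-- the topology `τ` -/
  top : TopologicalSpace X
  isTopologicalAddGroup : @IsTopologicalAddGroup X top _
  continuousSMul : @ContinuousSMul ℂ X _ _ top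
  locallyConvexSpace : @LocallyConvexSpace ℝ X _ _ _ _ top
  t2Space : @T2Space X top
  compatible :
    {g : X →ₗ[ℂ] ℂ | Continuous[top, inferInstance] g} = normDual X ∨
    (∃ (Y : Type u) (_ : NormedAddCommGroup Y) (_ : NormedSpace ℂ Y) (_ : CompleteSpace Y)
      (Φ : X ≃ₗᵢ[ℂ] StrongDual ℂ Y),
      {g : X →ₗ[ℂ] ℂ | Continuous[top, inferInstance] g} = predualFunctionals Φ)

namespace CompatibleTopology

variable {X : Type u} [NormedAddCommGroup X] [NormedSpace ℂ X]

/-- The topological vector space `(X, τ)`: the vector space `X` with the topology `τ`. -/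
def Space (_τ : CompatibleTopology X) : Type u := X

instance (τ : CompatibleTopology X) : AddCommGroup τ.Space := inferInstanceAs (AddCommGroup X)

instance (τ : CompatibleTopology X) : Module ℂ τ.Space := inferInstanceAs (Module ℂ X)

instance (τ : CompatibleTopology X) : TopologicalSpace τ.Space := τ.top

instance (τ : CompatibleTopology X) : IsTopologicalAddGroup τ.Space := τ.isTopologicalAddGroup

instance (τ : CompatibleTopology X) : ContinuousSMul ℂ τ.Space := τ.continuousSMul

instance (τ : CompatibleTopology X) : LocallyConvexSpace ℝ τ.Space := τ.locallyConvexSpace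

instance (τ : CompatibleTopology X) : T2Space τ.Space := τ.t2Space

/-- The identity map from `(X, τ)` to the normed space `X`. -/
def toNormed (τ : CompatibleTopology X) : τ.Space ≃ₗ[ℂ] X := LinearEquiv.refl ℂ X

/-- A `τ`-continuous function on a compact space is bounded in norm. -/
theorem bddAbove_norm {K : Type v} [TopologicalSpace K] [CompactSpace K]
    (τ : CompatibleTopology X) (f : C(K, τ.Space)) :
    BddAbove (range fun t => ‖τ.toNormed (f t)‖) := by
  have key : ∀ g : X →ₗ[ℂ] ℂ, Continuous[τ.top, inferInstance] g →
      ∃ C, ∀ t, ‖g (τ.toNormed (f t))‖ ≤ C := by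
    intro g hg
    have hg' : Continuous (fun z : τ.Space => g (τ.toNormed z)) := hg
    obtain ⟨C, hC⟩ := (isCompact_range (hg'.comp f.continuous).norm).bddAbove
    exact ⟨C, fun t => hC ⟨t, rfl⟩⟩
  rcases τ.compatible with h | ⟨Y, _, _, _, Φ, h⟩
  · obtain ⟨C, hC⟩ := banach_steinhaus
      (g := fun t : K => NormedSpace.inclusionInDoubleDual ℂ X (τ.toNormed (f t)))
      (fun g => key g.toLinearMap (h.symm.subset (show g.toLinearMap ∈ normDual X from g.continuous)))
    refine ⟨C, ?_⟩
    rintro _ ⟨t, rfl⟩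
    have := hC t
    rwa [show ‖NormedSpace.inclusionInDoubleDual ℂ X (τ.toNormed (f t))‖ = ‖τ.toNormed (f t)‖ from
      (NormedSpace.inclusionInDoubleDualLi ℂ (E := X)).norm_map _] at this
  · obtain ⟨C, hC⟩ := banach_steinhaus (g := fun t : K => Φ (τ.toNormed (f t))) (by
      intro y
      exact key ⟨⟨fun x => Φ x y, by simp⟩, by simp⟩ (h.symm.subset ⟨y, fun _ => rfl⟩))
    refine ⟨C, ?_⟩
    rintro _ ⟨t, rfl⟩
    simpa using hC t

end CompatibleTopology

/-- The space `C(K, (X, τ))` of all `τ`-continuous functions from `K` to `X`; it is a separate type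
because it carries the supremum norm, not the compact-open topology. -/
def TauContinuousMap (K : Type v) [TopologicalSpace K] {X : Type u} [NormedAddCommGroup X]
    [NormedSpace ℂ X] (τ : CompatibleTopology X) : Type (max u v) :=
  C(K, τ.Space)

namespace TauContinuousMap

variable {K : Type v} [TopologicalSpace K] {X : Type u} [NormedAddCommGroup X] [NormedSpace ℂ X]
  {τ : CompatibleTopology X}

instance : AddCommGroup (TauContinuousMap K τ) := inferInstanceAs (AddCommGroup C(K, τ.Space))

instance : Module ℂ (TauContinuousMap K τ) := inferInstanceAs (Module ℂ C(K, τ.Space))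

instance : FunLike (TauContinuousMap K τ) K τ.Space := inferInstanceAs (FunLike C(K, τ.Space) K _)

/-- The supremum norm `‖f‖ = sup_t ‖f t‖_X`. -/
noncomputable instance : Norm (TauContinuousMap K τ) := ⟨fun f => ⨆ t, ‖τ.toNormed (f t)‖⟩

theorem norm_def (f : TauContinuousMap K τ) : ‖f‖ = ⨆ t, ‖τ.toNormed (f t)‖ := rfl

variable [CompactSpace K]

theorem norm_apply_le (f : TauContinuousMap K τ) (t : K) : ‖τ.toNormed (f t)‖ ≤ ‖f‖ :=
  le_ciSup (τ.bddAbove_norm f) t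

theorem core : NormedSpace.Core ℂ (TauContinuousMap K τ) where
  norm_nonneg f := Real.iSup_nonneg fun _ => norm_nonneg _
  norm_smul c f := by
    have h : ∀ t, ‖τ.toNormed ((c • f) t)‖ = ‖c‖ * ‖τ.toNormed (f t)‖ := fun t =>
      norm_smul c (τ.toNormed (f t))
    simp only [norm_def, h]
    exact (Real.mul_iSup_of_nonneg (norm_nonneg c) _).symm
  norm_triangle f g := by
    refine Real.iSup_le (fun t => ?_)
      (add_nonneg (Real.iSup_nonneg fun _ => norm_nonneg _) (Real.iSup_nonneg fun _ => norm_nonneg _))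
    exact (norm_add_le (τ.toNormed (f t)) (τ.toNormed (g t))).trans
      (add_le_add (norm_apply_le f t) (norm_apply_le g t))
  norm_eq_zero_iff f := by
    constructor
    · intro h
      refine DFunLike.ext f 0 fun t => ?_
      have h1 : ‖τ.toNormed (f t)‖ ≤ 0 := h ▸ norm_apply_le f t
      exact norm_le_zero_iff.1 h1
    · rintro rfl
      have h : ∀ t : K, ‖τ.toNormed ((0 : TauContinuousMap K τ) t)‖ = 0 := fun t =>
        norm_zero (E := X)
      simp only [norm_def, h, Real.iSup_const_zero]

noncomputable instance : NormedAddCommGroup (TauContinuousMap K τ) := NormedAddCommGroup.ofCore core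

noncomputable instance : NormedSpace ℂ (TauContinuousMap K τ) := NormedSpace.ofCore core

end TauContinuousMap

section FunctionSpace

variable {K : Type v} [TopologicalSpace K] [CompactSpace K] {X : Type u} [NormedAddCommGroup X]
  [NormedSpace ℂ X] {τ : CompatibleTopology X}

/-- The pointwise product `φ f` of a scalar function and a vector-valued function. -/
noncomputable def TauContinuousMap.mulScalar (φ : C(K, ℂ)) (f : TauContinuousMap K τ) : TauContinuousMap K τ :=
  (⟨fun t => φ t • f t, φ.continuous.smul (ContinuousMap.continuous (Y := τ.Space) f)⟩ :
    C(K, τ.Space))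

/-- The composition `y^* ∘ f` with a functional `y^* ∈ (X, τ)^*`. -/
noncomputable def TauContinuousMap.compDual (y : τ.Space →L[ℂ] ℂ) (f : TauContinuousMap K τ) : C(K, ℂ) :=
  ⟨fun t => y (f t), y.continuous.comp (ContinuousMap.continuous (Y := τ.Space) f)⟩

/-- A uniform algebra on `K`: a closed subalgebra of `C(K)` that separates points and contains the
constants (as every `Subalgebra ℂ C(K, ℂ)` does). -/
structure IsUniformAlgebra (A : Subalgebra ℂ C(K, ℂ)) : Prop where
  isClosed : IsClosed (A : Set C(K, ℂ))
  separatesPoints : ∀ s t : K, s ≠ t → ∃ φ ∈ A, φ s ≠ φ t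

/-- `S` is an `(X, τ)`-valued function space `A(K, (X, τ))` with base algebra `A`. -/
structure IsFunctionSpaceOver (S : Submodule ℂ (TauContinuousMap K τ))
    (A : Subalgebra ℂ C(K, ℂ)) : Prop where
  isClosed : IsClosed (S : Set (TauContinuousMap K τ))
  base_eq : (A : Set C(K, ℂ)) = {φ | ∃ f ∈ S, ∃ y : τ.Space →L[ℂ] ℂ, φ = f.compDual y}
  isUniformAlgebra : IsUniformAlgebra A
  mul_mem : ∀ φ ∈ A, ∀ f ∈ S, f.mulScalar φ ∈ S

end FunctionSpace

/-- The diameter two property: every nonempty relatively weakly open subset of the closed unit ball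
has diameter `2`. -/
def HasDiameterTwoProperty (E : Type*) [NormedAddCommGroup E] [NormedSpace ℂ E] : Prop :=
  ∀ W : Set (WeakSpace ℂ E), IsOpen W →
    (toWeakSpace ℂ E ⁻¹' W ∩ Metric.closedBall (0 : E) 1).Nonempty →
    Metric.diam (toWeakSpace ℂ E ⁻¹' W ∩ Metric.closedBall (0 : E) 1) = 2

/-! Every `x` in the unit ball gets two weakly null perturbations that almost stay in the ball and
lie almost 2 apart; `HasDiameterTwoProperty.of_weaklyNull` then gives the diameter. The
perturbations are `ψ k • (± h k - x)` with `ψ k ∈ A` and `h k` of norm one.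

The scalar functions come from a peaking function `G ∈ A` whose range has `1` as a non-isolated
point; it exists because `A` is infinite dimensional (`exists_isPeaking_not_isolated`). For suitable
exponents the powers `q j = G ^ n j` are, at each point `t`, near 1 for `j` below some level `i` and
near 0 above it, with only `j = i` uncontrolled (`IsPeaking.exists_steps`). Averaging `N`
differences of such powers gives `ψ k`, within `O(1/N)` of a real number in `[0, 1]`, up to small
errors. Hence `‖ψ‖ + ‖1 - ψ‖` is almost at most 1, so `ψ h + (1 - ψ) x` is almost in the ball. At
each point only boundedly many `ψ k` are not small, so the sums of `‖ψ k t‖` are uniformly bounded,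
which forces weak nullity (`weaklyNull_mulScalar`).

The vector `h k` is the normalisation of `p k • f`, where `f` is bounded away from zero and `p k = q
(k + N) - q (k + N + 2)`. Its norm can only be nearly attained where `ψ k` is near 1, so the two
perturbations differ by almost 2 in norm. -/

/-! ### Weakly null perturbations and the diameter -/

open Filter in
theorem tendsto_toWeakSpace {E : Type*} [NormedAddCommGroup E] [NormedSpace ℂ E] {u : ℕ → E} {x : E}
    (h : ∀ L : StrongDual ℂ E, Tendsto (fun k => L (u k)) atTop (𝓝 (L x))) :
    Tendsto (fun k => toWeakSpace ℂ E (u k)) atTop (𝓝 (toWeakSpace ℂ E x)) := by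
  have hinj : Function.Injective (topDualPairing ℂ E).flip := by
    intro a b hab
    by_contra hne
    obtain ⟨L, hL⟩ := SeparatingDual.exists_separating_of_ne (R := ℂ) hne
    exact hL (by simpa using LinearMap.congr_fun hab L)
  exact (WeakBilin.tendsto_iff_forall_eval_tendsto (topDualPairing ℂ E).flip hinj).2 h

open Filter in
/-- If every point of the unit ball has two weakly null perturbations that almost stay in the ball
and are almost at distance `2` from each other, then the space has the diameter two property. -/
theorem HasDiameterTwoProperty.of_weaklyNull {E : Type*} [NormedAddCommGroup E] [NormedSpace ℂ E]
    (h : ∀ x : E, ‖x‖ ≤ 1 → ∀ ε : ℝ, 0 < ε → ε < 1 → ∃ u w : ℕ → E,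
      (∀ L : StrongDual ℂ E, Tendsto (fun k => L (u k)) atTop (𝓝 0)) ∧
      (∀ L : StrongDual ℂ E, Tendsto (fun k => L (w k)) atTop (𝓝 0)) ∧
      ∀ k, ‖x + u k‖ ≤ 1 + ε ∧ ‖x + w k‖ ≤ 1 + ε ∧ 2 * (1 - ε) ^ 2 ≤ ‖u k - w k‖) :
    HasDiameterTwoProperty E := by
  rintro W hW ⟨x, hxW, hx⟩
  rw [mem_closedBall_zero_iff] at hx
  set D := toWeakSpace ℂ E ⁻¹' W ∩ Metric.closedBall (0 : E) 1 with hD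
  have hbdd : Bornology.IsBounded D := Metric.isBounded_closedBall.subset inter_subset_right
  apply le_antisymm
  · calc Metric.diam D ≤ Metric.diam (Metric.closedBall (0 : E) 1) :=
          Metric.diam_mono inter_subset_right Metric.isBounded_closedBall
      _ ≤ 2 * 1 := Metric.diam_closedBall zero_le_one
      _ = 2 := by norm_num
  have hopen : IsOpen (toWeakSpace ℂ E ⁻¹' W) := hW.preimage (toWeakSpaceCLM ℂ E).continuous
  -- Division by `1 + ε` brings the perturbed points back into the ball; for small `ε` the rescaled
  -- centre is still in the open set.
  have hcont : Tendsto (fun ε : ℝ => ((((1 + ε)⁻¹ : ℝ) : ℂ)) • x) (𝓝[>] 0) (𝓝 x) := by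
    have : ContinuousAt (fun ε : ℝ => ((((1 + ε)⁻¹ : ℝ) : ℂ)) • x) 0 := by
      refine ContinuousAt.smul (Complex.continuous_ofReal.continuousAt.comp ?_) continuousAt_const
      exact ContinuousAt.inv₀ (by fun_prop) (by norm_num)
    have h2 := this.tendsto
    simp only [add_zero, inv_one, Complex.ofReal_one, one_smul] at h2
    exact h2.mono_left nhdsWithin_le_nhds
  have hev : ∀ᶠ ε : ℝ in 𝓝[>] 0, 2 * (1 - ε) ^ 2 / (1 + ε) ≤ Metric.diam D := by
    filter_upwards [hcont.eventually (hopen.mem_nhds hxW), self_mem_nhdsWithin,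
      nhdsWithin_le_nhds (Iio_mem_nhds (zero_lt_one (α := ℝ)))] with ε hεW hε0 hε1
    rw [mem_Ioi] at hε0
    obtain ⟨u, w, hu, hw, huw⟩ := h x hx ε hε0 hε1
    set c : ℂ := (((1 + ε)⁻¹ : ℝ) : ℂ) with hc
    have hpos : 0 < 1 + ε := by linarith
    have hcn : ‖c‖ = (1 + ε)⁻¹ := by
      rw [hc, Complex.norm_real, Real.norm_of_nonneg (inv_nonneg.2 hpos.le)]
    have key : ∀ z : ℕ → E, (∀ L : StrongDual ℂ E, Tendsto (fun k => L (z k)) atTop (𝓝 0)) →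
        ∀ᶠ k in atTop, toWeakSpace ℂ E (c • (x + z k)) ∈ W := by
      intro z hz
      refine (tendsto_toWeakSpace (x := c • x) fun L => ?_).eventually (hW.mem_nhds hεW)
      have h1 := ((hz L).const_add (L x)).const_mul c
      simpa [mul_add] using h1
    have hball : ∀ z : E, ‖x + z‖ ≤ 1 + ε → c • (x + z) ∈ Metric.closedBall (0 : E) 1 := by
      intro z hz
      rw [mem_closedBall_zero_iff, norm_smul, hcn, inv_mul_le_iff₀ hpos, mul_one]
      exact hz
    obtain ⟨k, hku, hkw⟩ := ((key u hu).and (key w hw)).exists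
    obtain ⟨h1, h2, h3⟩ := huw k
    calc 2 * (1 - ε) ^ 2 / (1 + ε) ≤ ‖u k - w k‖ / (1 + ε) := by gcongr
      _ = dist (c • (x + u k)) (c • (x + w k)) := by
        rw [dist_eq_norm, ← smul_sub, norm_smul, hcn, add_sub_add_left_eq_sub, div_eq_inv_mul]
      _ ≤ Metric.diam D := Metric.dist_le_diam_of_mem hbdd ⟨hku, hball _ h1⟩ ⟨hkw, hball _ h2⟩
  have hlim : Tendsto (fun ε : ℝ => 2 * (1 - ε) ^ 2 / (1 + ε)) (𝓝[>] 0) (𝓝 2) := by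
    have : ContinuousAt (fun ε : ℝ => 2 * (1 - ε) ^ 2 / (1 + ε)) 0 :=
      ContinuousAt.div (by fun_prop) (by fun_prop) (by norm_num)
    have h2 := this.tendsto
    norm_num at h2
    exact h2.mono_left nhdsWithin_le_nhds
  exact le_of_tendsto hlim hev

/-! ### Weakly null products in the function space -/

namespace TauContinuousMap

variable {K : Type v} [TopologicalSpace K] {X : Type u} [NormedAddCommGroup X]
  [NormedSpace ℂ X] {τ : CompatibleTopology X}

theorem toNormed_add_apply (f g : TauContinuousMap K τ) (t : K) :
    τ.toNormed ((f + g) t) = τ.toNormed (f t) + τ.toNormed (g t) := rfl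

theorem toNormed_sub_apply (f g : TauContinuousMap K τ) (t : K) :
    τ.toNormed ((f - g) t) = τ.toNormed (f t) - τ.toNormed (g t) := rfl

theorem toNormed_smul_apply (c : ℂ) (f : TauContinuousMap K τ) (t : K) :
    τ.toNormed ((c • f) t) = c • τ.toNormed (f t) := rfl

theorem toNormed_mulScalar_apply (φ : C(K, ℂ)) (f : TauContinuousMap K τ) (t : K) :
    τ.toNormed (f.mulScalar φ t) = φ t • τ.toNormed (f t) := rfl

theorem norm_le_of_forall {f : TauContinuousMap K τ} {C : ℝ} (hC : 0 ≤ C)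
    (h : ∀ t, ‖τ.toNormed (f t)‖ ≤ C) : ‖f‖ ≤ C := Real.iSup_le h hC

theorem exists_lt_norm_apply [Nonempty K] (f : TauContinuousMap K τ) {r : ℝ} (hr : r < ‖f‖) :
    ∃ t, r < ‖τ.toNormed (f t)‖ := exists_lt_of_lt_ciSup hr

variable [CompactSpace K]

/-- Evaluation at a point, as a linear map into the normed space. -/
def evalNormed (τ : CompatibleTopology X) (t : K) : TauContinuousMap K τ →ₗ[ℂ] X where
  toFun f := τ.toNormed (f t)
  map_add' _ _ := rfl
  map_smul' _ _ := rfl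

/-- With phases `θ k` chosen so that `θ k * L (u k) = ‖L (u k)‖`, the partial sums of `θ k • u k`
have norm at most `C * M`. Hence `∑ ‖L (u k)‖` converges and its terms tend to 0. -/
theorem weaklyNull_mulScalar {S : Submodule ℂ (TauContinuousMap K τ)} {ψ : ℕ → C(K, ℂ)} {C M : ℝ}
    (hC : ∀ n t, ∑ k ∈ Finset.range n, ‖ψ k t‖ ≤ C) {w : ℕ → TauContinuousMap K τ}
    (hM : ∀ k, ‖w k‖ ≤ M) {u : ℕ → S} (hu : ∀ k, (u k : TauContinuousMap K τ) = (w k).mulScalar (ψ k))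
    (L : StrongDual ℂ S) : Filter.Tendsto (fun k => L (u k)) Filter.atTop (𝓝 0) := by
  have hM0 : 0 ≤ M := (norm_nonneg _).trans (hM 0)
  rcases isEmpty_or_nonempty K with hK | ⟨⟨t₀⟩⟩
  · have : ∀ k, u k = 0 := fun k => Subtype.ext (DFunLike.ext _ _ fun t => hK.elim t)
    simp [this]
  have hC0 : 0 ≤ C := by simpa using hC 0 t₀
  have hsum : Summable fun k => ‖L (u k)‖ := by
    refine summable_of_sum_range_le (c := ‖L‖ * (C * M)) (fun _ => norm_nonneg _) fun n => ?_
    have hθ : ∀ z : ℂ, ∃ θ : ℂ, ‖θ‖ ≤ 1 ∧ θ * z = ‖z‖ := by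
      intro z
      rcases eq_or_ne z 0 with rfl | hz
      · exact ⟨0, by simp⟩
      · refine ⟨‖z‖ / z, ?_, ?_⟩
        · simp [hz]
        · field_simp
    choose θ hθ1 hθ2 using fun k => hθ (L (u k))
    set v : S := ∑ k ∈ Finset.range n, θ k • u k with hv
    have hLv : L v = ((∑ k ∈ Finset.range n, ‖L (u k)‖ : ℝ) : ℂ) := by
      simp [hv, map_sum, hθ2]
    have hvn : ‖v‖ ≤ C * M := by
      refine norm_le_of_forall (f := (v : TauContinuousMap K τ)) (mul_nonneg hC0 hM0) fun t => ?_
      have e : τ.toNormed ((v : TauContinuousMap K τ) t) =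
          ∑ k ∈ Finset.range n, θ k • (ψ k t • τ.toNormed (w k t)) := by
        change evalNormed τ t (v : TauContinuousMap K τ) = _
        rw [hv, Submodule.coe_sum, map_sum]
        refine Finset.sum_congr rfl fun k _ => ?_
        rw [Submodule.coe_smul, map_smul, hu]
        rfl
      rw [e]
      calc _ ≤ ∑ k ∈ Finset.range n, ‖θ k • (ψ k t • τ.toNormed (w k t))‖ := norm_sum_le _ _
        _ ≤ ∑ k ∈ Finset.range n, ‖ψ k t‖ * M := by
          refine Finset.sum_le_sum fun k _ => ?_
          rw [norm_smul, norm_smul]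
          have h1 : ‖τ.toNormed (w k t)‖ ≤ M := (norm_apply_le _ _).trans (hM k)
          calc _ ≤ 1 * (‖ψ k t‖ * M) := by gcongr; exact hθ1 k
            _ = _ := one_mul _
        _ = (∑ k ∈ Finset.range n, ‖ψ k t‖) * M := (Finset.sum_mul _ _ _).symm
        _ ≤ C * M := by gcongr; exact hC n t
    calc ∑ k ∈ Finset.range n, ‖L (u k)‖ = ‖L v‖ := by
          rw [hLv, Complex.norm_real, Real.norm_of_nonneg (Finset.sum_nonneg fun _ _ => norm_nonneg _)]
      _ ≤ ‖L‖ * ‖v‖ := L.le_opNorm v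
      _ ≤ ‖L‖ * (C * M) := by gcongr
  exact squeeze_zero_norm (fun _ => le_rfl) hsum.tendsto_atTop_zero

/-- A `τ`-continuous functional is bounded for the norm. -/
theorem _root_.CompatibleTopology.exists_norm_le (τ : CompatibleTopology X) (y : τ.Space →L[ℂ] ℂ) :
    ∃ C : ℝ, 0 < C ∧ ∀ x : τ.Space, ‖y x‖ ≤ C * ‖τ.toNormed x‖ := by
  have hy : (y.toLinearMap ∘ₗ τ.toNormed.symm.toLinearMap : X →ₗ[ℂ] ℂ) ∈
      {g : X →ₗ[ℂ] ℂ | Continuous[τ.top, inferInstance] g} := y.continuous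
  have key : ∀ g : StrongDual ℂ X, (∀ x : τ.Space, g (τ.toNormed x) = y x) →
      ∃ C : ℝ, 0 < C ∧ ∀ x : τ.Space, ‖y x‖ ≤ C * ‖τ.toNormed x‖ := by
    intro g hg
    refine ⟨‖g‖ + 1, by positivity, fun x => ?_⟩
    rw [← hg]
    refine (g.le_opNorm _).trans ?_
    gcongr
    linarith
  -- Either `y` is norm continuous outright, or it is evaluation at a point of the predual, hence
  -- again norm bounded.
  rcases τ.compatible with h | ⟨Y, _, _, _, Φ, h⟩
  · rw [h] at hy
    exact key ⟨_, hy⟩ fun x => rfl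
  · rw [h] at hy
    obtain ⟨z, hz⟩ := hy
    exact key ((ContinuousLinearMap.apply ℂ ℂ z).comp (Φ : X →L[ℂ] StrongDual ℂ Y))
      fun x => (hz (τ.toNormed x)).symm

end TauContinuousMap

/-! ### Scalar sequences with one step and their averages -/

/-- The numbers `a j`, `j < m`, are close to `1` for `j < i` and close to `0` for `i < j`. -/
def IsStepAt (η : ℕ → ℝ) (a : ℕ → ℂ) (i m : ℕ) : Prop :=
  ∀ j < m, (j < i → ‖1 - a j‖ ≤ η j) ∧ (i < j → ‖a j‖ ≤ η j)

/-- The average of `N` differences of terms of a sequence. -/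
noncomputable def stepAverage {V : Type*} [AddCommGroup V] [Module ℂ V] (a : ℕ → V) (N k : ℕ) : V :=
  (N : ℂ)⁻¹ • ∑ l ∈ Finset.range N, (a (k + l) - a (k + N + 3 + l))

section

variable {η : ℕ → ℝ} {a : ℕ → ℂ} {i m N k : ℕ}

theorem norm_inv_smul_sum_le {x : ℕ → ℂ} {C : ℝ} (hC : 0 ≤ C)
    (hx : ∀ l < N, ‖x l‖ ≤ C) : ‖(N : ℂ)⁻¹ • ∑ l ∈ Finset.range N, x l‖ ≤ C := by
  rcases Nat.eq_zero_or_pos N with rfl | hN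
  · simpa using hC
  have hN' : (0 : ℝ) < N := by exact_mod_cast hN
  rw [norm_smul, norm_inv, Complex.norm_natCast, inv_mul_le_iff₀ hN']
  calc _ ≤ ∑ l ∈ Finset.range N, ‖x l‖ := norm_sum_le _ _
    _ ≤ ∑ l ∈ Finset.range N, C := Finset.sum_le_sum fun l hl => hx l (Finset.mem_range.1 hl)
    _ = N * C := by simp

theorem norm_stepAverage_le_two (ha : ∀ j, ‖a j‖ ≤ 1) : ‖stepAverage a N k‖ ≤ 2 :=
  norm_inv_smul_sum_le (by norm_num) fun l _ =>
    (norm_sub_le _ _).trans (by linarith [ha (k + l), ha (k + N + 3 + l)])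

theorem IsStepAt.norm_sub_le (h : IsStepAt η a i m) (hη : Antitone η) {j j' : ℕ} (hj : k ≤ j)
    (hj' : k ≤ j') (hjm : j < m) (hjm' : j' < m) (hi : j < i ∧ j' < i ∨ i < j ∧ i < j') :
    ‖a j - a j'‖ ≤ 2 * η k := by
  have h1 := hη hj
  have h2 := hη hj'
  rcases hi with ⟨h3, h4⟩ | ⟨h3, h4⟩
  · have := (h j hjm).1 h3
    have h6 := (h j' hjm').1 h4
    calc ‖a j - a j'‖ = ‖(1 - a j') - (1 - a j)‖ := by congr 1; ring
      _ ≤ ‖1 - a j'‖ + ‖1 - a j‖ := _root_.norm_sub_le _ _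
      _ ≤ 2 * η k := by linarith
  · have := (h j hjm).2 h3
    have h6 := (h j' hjm').2 h4
    exact (_root_.norm_sub_le _ _).trans (by linarith)

theorem IsStepAt.norm_one_sub_sub_le (h : IsStepAt η a i m) (hη : Antitone η) {j j' : ℕ}
    (hj : k ≤ j) (hj' : k ≤ j') (hjm : j < m) (hjm' : j' < m) (h1 : j < i) (h2 : i < j') :
    ‖1 - (a j - a j')‖ ≤ 2 * η k := by
  have h3 := hη hj
  have h4 := hη hj'
  have h5 := (h j hjm).1 h1
  have h6 := (h j' hjm').2 h2
  calc ‖1 - (a j - a j')‖ = ‖(1 - a j) + a j'‖ := by congr 1; ring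
    _ ≤ ‖1 - a j‖ + ‖a j'‖ := norm_add_le _ _
    _ ≤ 2 * η k := by linarith

/-- All indices in the average lie in `[k, k + 2 * N + 3)`. A level outside this window has both
indices of every difference on the same side. -/
theorem IsStepAt.norm_stepAverage_le (h : IsStepAt η a i m) (hη : Antitone η) (hη0 : ∀ j, 0 ≤ η j)
    (hm : k + 2 * N + 3 ≤ m) (hi : i < k ∨ k + 2 * N + 3 ≤ i) :
    ‖stepAverage a N k‖ ≤ 2 * η k :=
  norm_inv_smul_sum_le (by linarith [hη0 k]) fun l hl =>
    h.norm_sub_le hη (by omega) (by omega) (by omega) (by omega) (by omega)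

/-- The gap between the two blocks of indices holds exactly the three levels `k + N`, `k + N + 1`,
`k + N + 2`; for these every difference straddles the step. -/
theorem IsStepAt.norm_one_sub_stepAverage_le (h : IsStepAt η a i m) (hη : Antitone η)
    (hη0 : ∀ j, 0 ≤ η j) (hN : 0 < N) (hm : k + 2 * N + 3 ≤ m) (hi : k + N ≤ i)
    (hi' : i ≤ k + N + 2) : ‖1 - stepAverage a N k‖ ≤ 2 * η k := by
  have hN' : (N : ℂ) ≠ 0 := by exact_mod_cast hN.ne'
  have e : 1 - stepAverage a N k =
      (N : ℂ)⁻¹ • ∑ l ∈ Finset.range N, (1 - (a (k + l) - a (k + N + 3 + l))) := by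
    rw [stepAverage, Finset.sum_sub_distrib (f := fun _ => (1 : ℂ)), smul_sub]
    simp [hN']
  rw [e]
  exact norm_inv_smul_sum_le (by linarith [hη0 k]) fun l hl =>
    h.norm_one_sub_sub_le hη (by omega) (by omega) (by omega) (by omega) (by omega) (by omega)

theorem IsStepAt.sum_norm_stepAverage_le (ha : ∀ j, ‖a j‖ ≤ 1) (hη : Antitone η)
    (hη0 : ∀ j, 0 ≤ η j) {C : ℝ} (hC : ∀ n, ∑ k ∈ Finset.range n, η k ≤ C) {n : ℕ}
    (h : IsStepAt η a i (n + 2 * N + 3)) :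
    ∑ k ∈ Finset.range n, ‖stepAverage a N k‖ ≤ 2 * C + 2 * (2 * N + 3) := by
  have h1 : ∀ k ∈ Finset.range n, ‖stepAverage a N k‖ ≤
      -- The exceptional `k` are those with `k ≤ i < k + 2 * N + 3`; truncated subtraction is
      -- harmless here.
      2 * η k + if k ∈ Finset.Ico (i + 1 - (2 * N + 3)) (i + 1) then 2 else 0 := by
    intro k hk
    rw [Finset.mem_range] at hk
    split_ifs with hki
    · linarith [hη0 k, norm_stepAverage_le_two (N := N) (k := k) ha]
    · rw [Finset.mem_Ico] at hki
      rw [add_zero]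
      have h' : IsStepAt η a i (k + 2 * N + 3) := fun j hj => h j (by omega)
      exact h'.norm_stepAverage_le hη hη0 le_rfl (by omega)
  refine (Finset.sum_le_sum h1).trans ?_
  rw [Finset.sum_add_distrib, ← Finset.mul_sum, ← Finset.sum_filter, Finset.sum_const]
  have h2 : ((Finset.range n).filter
      (· ∈ Finset.Ico (i + 1 - (2 * N + 3)) (i + 1))).card ≤ 2 * N + 3 := by
    calc _ ≤ (Finset.Ico (i + 1 - (2 * N + 3)) (i + 1)).card :=
          Finset.card_le_card fun x hx => (Finset.mem_filter.1 hx).2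
      _ ≤ 2 * N + 3 := by rw [Nat.card_Ico]; omega
  have h3 : ((((Finset.range n).filter
      (· ∈ Finset.Ico (i + 1 - (2 * N + 3)) (i + 1))).card : ℕ) : ℝ) ≤ 2 * N + 3 := by
    exact_mod_cast h2
  rw [nsmul_eq_mul]
  linarith [hC n]

/-- Replacing `a` by the exact step `e` turns the average into a real `ρ ∈ [0, 1]`, for which `ρ +
(1 - ρ) = 1`. Only the index `j = i` is uncontrolled; it occurs at most once per block, so the
averaging reduces its effect to `O(1 / N)`. -/
theorem IsStepAt.norm_stepAverage_add_norm_one_sub_le (ha : ∀ j, ‖a j‖ ≤ 1) (hη : Antitone η)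
    (hη0 : ∀ j, 0 ≤ η j) (hN : 0 < N) (h : IsStepAt η a i m) (hm : k + 2 * N + 3 ≤ m) :
    ‖stepAverage a N k‖ + ‖1 - stepAverage a N k‖ ≤ 1 + 4 * η k + 4 / N := by
  have hN' : (0 : ℝ) < N := by exact_mod_cast hN
  set e : ℕ → ℝ := fun j => if j < i then 1 else 0 with he
  set ρ : ℝ := (N : ℝ)⁻¹ * ∑ l ∈ Finset.range N, (e (k + l) - e (k + N + 3 + l)) with hρ
  have hterm : ∀ l, 0 ≤ e (k + l) - e (k + N + 3 + l) ∧ e (k + l) - e (k + N + 3 + l) ≤ 1 := by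
    intro l
    simp only [he]
    split_ifs <;> first | omega | norm_num
  have hρ0 : 0 ≤ ρ := mul_nonneg (by positivity) (Finset.sum_nonneg fun l _ => (hterm l).1)
  have hρ1 : ρ ≤ 1 := by
    rw [hρ, inv_mul_le_iff₀ hN']
    calc _ ≤ ∑ l ∈ Finset.range N, (1 : ℝ) := Finset.sum_le_sum fun l _ => (hterm l).2
      _ = N * 1 := by simp
  have hclose : ∀ j, k ≤ j → j < m → ‖a j - e j‖ ≤ η k + if j = i then 1 else 0 := by
    intro j hkj hjm
    have h1 := hη hkj
    have h2 := hη0 k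
    rcases lt_trichotomy j i with hji | rfl | hji
    · have := (h j hjm).1 hji
      simp only [he, hji, hji.ne, if_true, if_false, Complex.ofReal_one, add_zero]
      rw [norm_sub_rev]
      linarith
    · simp only [he, lt_irrefl, if_false, Complex.ofReal_zero, sub_zero, if_true]
      linarith [ha j]
    · have := (h j hjm).2 hji
      simp only [he, hji.ne', hji.not_gt, if_false, Complex.ofReal_zero, sub_zero, add_zero]
      linarith
  have hdiff : ‖stepAverage a N k - ρ‖ ≤ 2 * η k + 2 / N := by
    have e1 : stepAverage a N k - ρ = (N : ℂ)⁻¹ • ∑ l ∈ Finset.range N,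
        ((a (k + l) - e (k + l)) - (a (k + N + 3 + l) - e (k + N + 3 + l))) := by
      rw [stepAverage, hρ]
      push_cast
      rw [smul_eq_mul, smul_eq_mul, ← mul_sub, ← Finset.sum_sub_distrib]
      congr 1
      exact Finset.sum_congr rfl fun l _ => by ring
    rw [e1, norm_smul, norm_inv, Complex.norm_natCast, inv_mul_le_iff₀ hN']
    have hone : ∀ b : ℕ, ∑ l ∈ Finset.range N, (if b + l = i then (1 : ℝ) else 0) ≤ 1 := by
      intro b
      rw [← Finset.sum_filter, Finset.sum_const, nsmul_eq_mul, mul_one]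
      have : ((Finset.range N).filter fun l => b + l = i).card ≤ 1 :=
        Finset.card_le_one.2 fun x hx y hy => by
          have := (Finset.mem_filter.1 hx).2
          have := (Finset.mem_filter.1 hy).2
          omega
      exact_mod_cast this
    calc _ ≤ ∑ l ∈ Finset.range N,
          ‖(a (k + l) - e (k + l)) - (a (k + N + 3 + l) - e (k + N + 3 + l))‖ := norm_sum_le _ _
      _ ≤ ∑ l ∈ Finset.range N, (2 * η k + ((if k + l = i then (1 : ℝ) else 0) +
          if k + N + 3 + l = i then (1 : ℝ) else 0)) := by
        refine Finset.sum_le_sum fun l hl => (_root_.norm_sub_le _ _).trans ?_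
        rw [Finset.mem_range] at hl
        have h1 := hclose (k + l) (by omega) (by omega)
        have h2 := hclose (k + N + 3 + l) (by omega) (by omega)
        linarith
      _ ≤ N * (2 * η k) + (1 + 1) := by
        rw [Finset.sum_add_distrib, Finset.sum_add_distrib]
        have h1 := hone k
        have h2 := hone (k + N + 3)
        simp only [Finset.sum_const, Finset.card_range, nsmul_eq_mul]
        linarith
      _ = N * (2 * η k + 2 / N) := by field_simp; ring
  have hA : ‖stepAverage a N k‖ ≤ ρ + (2 * η k + 2 / N) := by
    calc ‖stepAverage a N k‖ = ‖(ρ : ℂ) + (stepAverage a N k - ρ)‖ := by congr 1; ring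
      _ ≤ ‖(ρ : ℂ)‖ + ‖stepAverage a N k - ρ‖ := norm_add_le _ _
      _ ≤ _ := by rw [Complex.norm_real, Real.norm_of_nonneg hρ0]; gcongr
  have hB : ‖1 - stepAverage a N k‖ ≤ (1 - ρ) + (2 * η k + 2 / N) := by
    calc ‖1 - stepAverage a N k‖ = ‖((1 - ρ : ℝ) : ℂ) - (stepAverage a N k - ρ)‖ := by
          congr 1; push_cast; ring
      _ ≤ ‖((1 - ρ : ℝ) : ℂ)‖ + ‖stepAverage a N k - ρ‖ := _root_.norm_sub_le _ _
      _ ≤ _ := by rw [Complex.norm_real, Real.norm_of_nonneg (sub_nonneg.2 hρ1)]; gcongr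
  have : (4 : ℝ) / N = 2 / N + 2 / N := by ring
  linarith

end

/-! ### Peaking functions in closed subalgebras -/

section Peak

variable {K : Type v} [TopologicalSpace K]

/-- A function in the closed unit ball of `C(K)` that is equal to `1` wherever its modulus is `1`. -/
def IsPeaking (G : C(K, ℂ)) : Prop := ∀ t, ‖G t‖ < 1 ∨ G t = 1

theorem IsPeaking.norm_le_one {G : C(K, ℂ)} (hG : IsPeaking G) (t : K) : ‖G t‖ ≤ 1 := by
  rcases hG t with h | h
  · exact h.le
  · simp [h]

variable [CompactSpace K]

/-- By compactness `‖G‖` attains a maximum below 1 on the set where `r ≤ ‖1 - G t‖`. -/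
theorem IsPeaking.exists_pow_le {G : C(K, ℂ)} (hG : IsPeaking G) {r η : ℝ} (hr : 0 < r)
    (hη : 0 < η) : ∃ n₀ : ℕ, ∀ n ≥ n₀, ∀ t, r ≤ ‖1 - G t‖ → ‖G t ^ n‖ ≤ η := by
  have hcpt : IsCompact {t | r ≤ ‖1 - G t‖} :=
    (isClosed_le continuous_const (by fun_prop)).isCompact
  rcases Set.eq_empty_or_nonempty {t | r ≤ ‖1 - G t‖} with he | hne
  · exact ⟨0, fun n _ t ht => absurd (show t ∈ {t | r ≤ ‖1 - G t‖} from ht) (he ▸ notMem_empty t)⟩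
  obtain ⟨s, hs, hmax⟩ := hcpt.exists_isMaxOn hne (f := fun t => ‖G t‖) (by fun_prop)
  have hs1 : ‖G s‖ < 1 := by
    rcases hG s with h | h
    · exact h
    · have : r ≤ ‖1 - G s‖ := hs
      rw [h, sub_self, norm_zero] at this
      linarith
  obtain ⟨n₀, hn₀⟩ := exists_pow_lt_of_lt_one hη hs1
  refine ⟨n₀, fun n hn t ht => ?_⟩
  rw [norm_pow]
  calc ‖G t‖ ^ n ≤ ‖G s‖ ^ n := pow_le_pow_left₀ (norm_nonneg _) (hmax ht) _
    _ ≤ ‖G s‖ ^ n₀ := pow_le_pow_of_le_one (norm_nonneg _) hs1.le hn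
    _ ≤ η := hn₀.le

/-- If `1` is not isolated in the range of a peaking function `G`, then suitable powers of `G` are
almost two-valued at every point, and jump at every index somewhere. -/
theorem IsPeaking.exists_steps {G : C(K, ℂ)} (hG : IsPeaking G)
    (hacc : ∀ r > 0, ∃ t, 0 < ‖1 - G t‖ ∧ ‖1 - G t‖ < r) {η : ℕ → ℝ} (hη : ∀ j, 0 < η j) :
    ∃ n : ℕ → ℕ, (∀ t m, ∃ i, IsStepAt η (fun j => G t ^ n j) i m) ∧
      ∀ i, ∃ t, ∀ m, IsStepAt η (fun j => G t ^ n j) i m := by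
  have step : ∀ (j : ℕ) (r : {r : ℝ // 0 < r}), ∃ (r' : {r : ℝ // 0 < r}) (n : ℕ),
      (r' : ℝ) ≤ r ∧ (∀ t, (r : ℝ) ≤ ‖1 - G t‖ → ‖G t ^ n‖ ≤ η j) ∧
      (∀ t, ‖1 - G t‖ < r' → ‖1 - G t ^ n‖ ≤ η j) ∧
      ∃ t, (r' : ℝ) ≤ ‖1 - G t‖ ∧ ‖1 - G t‖ < r := by
    rintro j ⟨r, hr⟩
    obtain ⟨n, hn⟩ := hG.exists_pow_le hr (hη j)
    obtain ⟨t, ht0, htr⟩ := hacc r hr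
    have hc : ContinuousAt (fun z : ℂ => 1 - z ^ n) 1 := by fun_prop
    obtain ⟨δ, hδ, hδ'⟩ := Metric.continuousAt_iff.1 hc (η j) (hη j)
    -- `δ` keeps `G ^ n` near 1; the cap `‖1 - G t‖` ensures that some point lies between the radii
    -- `r'` and `r`.
    refine ⟨⟨min δ ‖1 - G t‖, lt_min hδ ht0⟩, n, (min_le_right _ _).trans htr.le, hn n le_rfl,
      fun s hs => ?_, t, min_le_right _ _, htr⟩
    have h1 : dist (G s) 1 < δ := by
      rw [dist_eq_norm, norm_sub_rev]
      exact hs.trans_le (min_le_left _ _)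
    have h2 := hδ' h1
    rw [dist_eq_norm] at h2
    simpa using h2.le
  choose R N hR hN hN' hT using step
  -- The level of `t` is the `i` with `r (i + 1) ≤ ‖1 - G t‖ < r i`. The start 3 exceeds every `‖1 -
  -- G t‖`, which is at most 2.
  let r : ℕ → {r : ℝ // 0 < r} := fun j => Nat.rec ⟨3, by norm_num⟩ (fun j r => R j r) j
  have hanti : Antitone fun j : ℕ => ((r j).1 : ℝ) :=
    antitone_nat_of_succ_le fun j => hR j (r j)
  have hlevel : ∀ t (i : ℕ), (r (i + 1) : ℝ) ≤ ‖1 - G t‖ → ‖1 - G t‖ < (r i).1 →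
      ∀ m, IsStepAt η (fun j => G t ^ N j (r j)) i m := by
    intro t i h1 h2 m j _
    refine ⟨fun hji => hN' j (r j) t ?_, fun hij => hN j (r j) t ?_⟩
    · exact h2.trans_le (hanti (show j + 1 ≤ i from hji))
    · exact (hanti (show i + 1 ≤ j from hij)).trans h1
  refine ⟨fun j => N j (r j), fun t m => ?_, fun i => ?_⟩
  · by_cases h : ∃ i : ℕ, (r (i + 1) : ℝ) ≤ ‖1 - G t‖
    · classical
      refine ⟨Nat.find h, hlevel t _ (Nat.find_spec h) ?_ m⟩
      rcases Nat.eq_zero_or_pos (Nat.find h) with h0 | h0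
      · rw [h0]
        have : ‖1 - G t‖ ≤ 1 + 1 := by
          simpa using (norm_sub_le 1 (G t)).trans (by simpa using hG.norm_le_one t)
        exact this.trans_lt (show (1 + 1 : ℝ) < 3 by norm_num)
      · have h3 := Nat.find_min h (Nat.sub_lt h0 one_pos)
        rw [show Nat.find h - 1 + 1 = Nat.find h by omega] at h3
        exact not_le.1 h3
    · push Not at h
      -- Below all radii (for instance where `G t = 1`) no step occurs, and `m` serves as the level
      -- since only `j < m` is tested.
      exact ⟨m, fun j hj => ⟨fun _ => hN' j (r j) t (h j), fun hmj => absurd hj hmj.not_gt⟩⟩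
  · obtain ⟨t, h1, h2⟩ := hT i (r i)
    exact ⟨t, hlevel t i h1 h2⟩

/-- If `1` is isolated in the range, `{G = 1}` is clopen and the powers of `G` converge uniformly to
its indicator, which lies in `A` by closedness. -/
theorem IsPeaking.exists_idempotent {A : Subalgebra ℂ C(K, ℂ)} (hA : IsClosed (A : Set C(K, ℂ)))
    {G : C(K, ℂ)} (hG : IsPeaking G) (hGA : G ∈ A) {r : ℝ} (hr : 0 < r)
    (hiso : ∀ t, ‖1 - G t‖ < r → G t = 1) :
    ∃ e ∈ A, ∀ t, e t = 0 ∧ G t ≠ 1 ∨ e t = 1 ∧ G t = 1 := by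
  classical
  have hclopen : IsClopen {t | G t = 1} := by
    refine ⟨isClosed_eq G.continuous continuous_const, ?_⟩
    have : {t | G t = 1} = {t | ‖1 - G t‖ < r} := by
      ext t
      exact ⟨fun h => by simpa [show G t = 1 from h] using hr, hiso t⟩
    rw [this]
    exact isOpen_lt (by fun_prop) continuous_const
  let e : C(K, ℂ) := ⟨fun t => if G t = 1 then 1 else 0,
    Continuous.if (fun t ht => by simp [hclopen.frontier_eq] at ht) continuous_const
      continuous_const⟩
  refine ⟨e, ?_, fun t => ?_⟩
  · rw [← SetLike.mem_coe, ← hA.closure_eq, Metric.mem_closure_iff]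
    intro ε hε
    obtain ⟨n, hn⟩ := hG.exists_pow_le hr (half_pos hε)
    refine ⟨G ^ n, A.pow_mem hGA n, lt_of_le_of_lt ?_ (half_lt_self hε)⟩
    rw [ContinuousMap.dist_le (half_pos hε).le]
    intro t
    change dist (if G t = 1 then (1 : ℂ) else 0) (G t ^ n) ≤ _
    split_ifs with h
    · simpa [h] using (half_pos hε).le
    · rw [dist_zero_left]
      refine hn n le_rfl t (le_of_not_gt fun h' => h (hiso t h'))
  · by_cases h : G t = 1
    · exact Or.inr ⟨if_pos h, h⟩
    · exact Or.inl ⟨if_neg h, h⟩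

/-- The ideal generated by `e` in a subalgebra, as a subspace. -/
noncomputable def Subalgebra.mulLeftSubmodule (A : Subalgebra ℂ C(K, ℂ)) (e : C(K, ℂ)) :
    Submodule ℂ C(K, ℂ) :=
  A.toSubmodule.map (LinearMap.mulLeft ℂ e)

/-- Some `u = e * g` is not a multiple of `e`. Normalised at a maximum point of its modulus, it
yields a peaking function whose set `{G = 1}` is a nonempty proper part of the support of `e`. This
splits `e`, and one of the two pieces still generates an infinite-dimensional ideal. -/
theorem exists_smaller_idempotent {A : Subalgebra ℂ C(K, ℂ)} (hA : IsClosed (A : Set C(K, ℂ)))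
    (H : ∀ G ∈ A, IsPeaking G → ∃ r > 0, ∀ t, ‖1 - G t‖ < r → G t = 1)
    {e : C(K, ℂ)} (heA : e ∈ A) (he : ∀ t, e t = 0 ∨ e t = 1)
    (hinf : ¬ FiniteDimensional ℂ (A.mulLeftSubmodule e)) :
    ∃ e' ∈ A, (∀ t, e' t = 0 ∨ e' t = 1) ∧ (∀ t, e' t = 1 → e t = 1) ∧
      (∃ t, e t = 1 ∧ e' t = 0) ∧ ¬ FiniteDimensional ℂ (A.mulLeftSubmodule e') := by
  have hex : ∃ g ∈ A, ¬ ∃ c : ℂ, e * g = c • e := by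
    by_contra! hcon
    refine hinf (Submodule.finiteDimensional_of_le (S₂ := Submodule.span ℂ {e}) ?_)
    rintro _ ⟨g, hg, rfl⟩
    obtain ⟨c, hc⟩ := hcon g hg
    exact Submodule.mem_span_singleton.2 ⟨c, hc.symm⟩
  obtain ⟨g, hgA, hg⟩ := hex
  set u := e * g with hu
  have huA : u ∈ A := A.mul_mem heA hgA
  have hne : u ≠ 0 := fun h => hg ⟨0, by rw [h, zero_smul]⟩
  obtain ⟨s, hs⟩ := DFunLike.ne_iff.1 hne
  obtain ⟨t₀, -, hmax⟩ := isCompact_univ.exists_isMaxOn ⟨s, mem_univ s⟩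
    (f := fun t => ‖u t‖) (by fun_prop)
  have hmax' : ∀ t, ‖u t‖ ≤ ‖u t₀‖ := fun t => hmax (mem_univ t)
  have ht₀ : u t₀ ≠ 0 := norm_pos_iff.1 ((norm_pos_iff.2 hs).trans_le (hmax' s))
  have het₀ : e t₀ = 1 := (he t₀).resolve_left fun h => ht₀ (by simp [hu, h])
  set w : C(K, ℂ) := (u t₀)⁻¹ • u with hw
  have hw1 : ∀ t, ‖w t‖ ≤ 1 := by
    intro t
    rw [hw, ContinuousMap.smul_apply, norm_smul, norm_inv, inv_mul_le_iff₀ (norm_pos_iff.2 ht₀),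
      mul_one]
    exact hmax' t
  set G : C(K, ℂ) := (2⁻¹ : ℂ) • (1 + w) with hGdef
  have hGt : ∀ t, G t = 2⁻¹ * (1 + w t) := fun t => rfl
  have hGA : G ∈ A := A.smul_mem (A.add_mem A.one_mem (A.smul_mem huA _)) _
  have hG1 : ∀ t, G t = 1 ↔ w t = 1 := by
    intro t
    rw [hGt]
    constructor
    · intro h
      linear_combination 2 * h
    · intro h
      rw [h]
      norm_num
  -- By strict convexity of the disc, `(1 + w) / 2` has modulus 1 only where `w = 1`.
  have hG : IsPeaking G := by
    intro t
    by_cases h : w t = 1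
    · exact Or.inr ((hG1 t).2 h)
    · left
      have h1 : ‖1 + w t‖ < 2 := by
        have h2 := norm_add_lt_of_not_sameRay (x := (1 : ℂ)) (y := w t)
        rcases lt_or_eq_of_le (hw1 t) with h3 | h3
        · calc ‖1 + w t‖ ≤ ‖(1 : ℂ)‖ + ‖w t‖ := norm_add_le _ _
            _ < 2 := by rw [norm_one]; linarith
        · have h4 : ¬ SameRay ℝ (1 : ℂ) (w t) := fun h5 =>
            h (((sameRay_iff_of_norm_eq (by rw [h3, norm_one])).1 h5).symm)
          have := h2 h4
          rw [norm_one, h3] at this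
          linarith
      rw [hGt, norm_mul, norm_inv, Complex.norm_ofNat]
      linarith
  obtain ⟨r, hr, hiso⟩ := H G hGA hG
  obtain ⟨e', he'A, he'⟩ := hG.exists_idempotent hA hGA hr hiso
  have he'01 : ∀ t, e' t = 0 ∨ e' t = 1 := fun t => (he' t).imp And.left And.left
  have hle : ∀ t, e' t = 1 → e t = 1 := by
    intro t ht
    refine (he t).resolve_left fun h => ?_
    rcases he' t with h1 | h1
    · simp [h1.1] at ht
    · have := (hG1 t).1 h1.2
      simp [hw, hu, h] at this
  have h0 : e' t₀ = 1 := by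
    rcases he' t₀ with h1 | h1
    · exact absurd ((hG1 t₀).2 (by simp [hw, ht₀])) h1.2
    · exact h1.1
  have hlt : ∃ t, e t = 1 ∧ e' t = 0 := by
    by_contra! hcon
    refine hg ⟨u t₀, ?_⟩
    ext t
    rcases he t with h | h
    · simp [hu, h]
    · have h1 : G t = 1 := by
        rcases he' t with h1 | h1
        · exact absurd h1.1 (hcon t h)
        · exact h1.2
      have h2 : (u t₀)⁻¹ * u t = 1 := (hG1 t).1 h1
      simp only [ContinuousMap.smul_apply, smul_eq_mul, h, mul_one]
      field_simp at h2
      exact h2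
  by_cases hfd : FiniteDimensional ℂ (A.mulLeftSubmodule e')
  · refine ⟨e - e', A.sub_mem heA he'A, fun t => ?_, fun t ht => ?_, ⟨t₀, het₀, ?_⟩, fun hfd' => ?_⟩
    · rcases he'01 t with h | h
      · simpa [h] using he t
      · simp [h, hle t h]
    · refine (he t).resolve_left fun h => ?_
      rcases he'01 t with h1 | h1
      · simp [h, h1] at ht
      · simp [hle t h1] at h
    · simp [het₀, h0]
    · refine hinf (Submodule.finiteDimensional_of_le
        (S₂ := A.mulLeftSubmodule e' ⊔ A.mulLeftSubmodule (e - e')) ?_)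
      rintro _ ⟨g, hg, rfl⟩
      refine Submodule.mem_sup.2 ⟨e' * g, ⟨g, hg, rfl⟩, (e - e') * g, ⟨g, hg, rfl⟩, ?_⟩
      simp [sub_mul]
  · exact ⟨e', he'A, he'01, hle, hlt, hfd⟩

/-- An infinite-dimensional closed unital subalgebra of `C(K)` contains a peaking function in whose
range `1` is not isolated. -/
theorem exists_isPeaking_not_isolated {A : Subalgebra ℂ C(K, ℂ)} (hA : IsClosed (A : Set C(K, ℂ)))
    (hinf : ¬ FiniteDimensional ℂ A) :
    ∃ G ∈ A, IsPeaking G ∧ ∀ r > 0, ∃ t, 0 < ‖1 - G t‖ ∧ ‖1 - G t‖ < r := by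
  by_contra! hcon
  have H : ∀ G ∈ A, IsPeaking G → ∃ r > 0, ∀ t, ‖1 - G t‖ < r → G t = 1 := by
    intro G hGA hG
    obtain ⟨r, hr, h⟩ := hcon G hGA hG
    refine ⟨r, hr, fun t ht => ?_⟩
    by_contra hne
    exact absurd ht (not_lt.2 (h t (norm_pos_iff.2 (sub_ne_zero.2 (Ne.symm hne)))))
  let I := {e : C(K, ℂ) // e ∈ A ∧ (∀ t, e t = 0 ∨ e t = 1) ∧
    ¬ FiniteDimensional ℂ (A.mulLeftSubmodule e)}
  have hstep : ∀ e : I, ∃ e' : I, (∀ t, e'.1 t = 1 → e.1 t = 1) ∧ ∃ t, e.1 t = 1 ∧ e'.1 t = 0 := by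
    rintro ⟨e, heA, he, hinf⟩
    obtain ⟨e', h1, h2, h3, h4, h5⟩ := exists_smaller_idempotent hA H heA he hinf
    exact ⟨⟨e', h1, h2, h5⟩, h3, h4⟩
  choose F hF1 hF2 using hstep
  have h1 : A.mulLeftSubmodule 1 = A.toSubmodule := by
    simp [Subalgebra.mulLeftSubmodule]
  -- If `1` were always isolated, there would be a strictly decreasing sequence of idempotents; the
  -- function `1 - ∑ 2 ^ -(j + 1) (1 - e j)` then peaks with `1` not isolated.
  let e : ℕ → I := fun j => Nat.rec ⟨1, A.one_mem, fun t => Or.inr rfl, by rw [h1]; exact hinf⟩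
    (fun _ e => F e) j
  have hle : ∀ j t, (e (j + 1)).1 t = 1 → (e j).1 t = 1 := fun j => hF1 (e j)
  have hlt : ∀ j, ∃ t, (e j).1 t = 1 ∧ (e (j + 1)).1 t = 0 := fun j => hF2 (e j)
  have hmono : ∀ t i j, i ≤ j → (e j).1 t = 1 → (e i).1 t = 1 := by
    intro t i j hij
    induction hij with
    | refl => exact id
    | step _ ih => exact fun h => ih (hle _ t h)
  have h01 : ∀ j t, (e j).1 t = 0 ∨ (e j).1 t = 1 := fun j => (e j).2.2.1
  set f : K → ℕ → ℝ := fun t j => (1 / 2) ^ (j + 1) * (1 - ((e j).1 t).re) with hf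
  have hgeom : HasSum (fun j : ℕ => (1 / 2 : ℝ) ^ (j + 1)) 1 := by
    have := hasSum_geometric_two.mul_left (1 / 2 : ℝ)
    simpa [pow_succ'] using this
  have hf0 : ∀ t j, 0 ≤ f t j ∧ f t j ≤ (1 / 2) ^ (j + 1) := by
    intro t j
    have : (0 : ℝ) < (1 / 2) ^ (j + 1) := by positivity
    rcases h01 j t with h | h <;> simp [hf, h]
  have hfs : ∀ t, Summable (f t) := fun t =>
    Summable.of_nonneg_of_le (fun j => (hf0 t j).1) (fun j => (hf0 t j).2) hgeom.summable
  set s : ℕ → C(K, ℂ) := fun j => (1 / 2 : ℂ) ^ (j + 1) • (1 - (e j).1) with hs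
  have hst : ∀ j t, s j t = (f t j : ℂ) := by
    intro j t
    rcases h01 j t with h | h <;> simp [hs, hf, h]
  have hsn : ∀ j, ‖s j‖ ≤ (1 / 2) ^ (j + 1) := by
    intro j
    refine (ContinuousMap.norm_le _ (by positivity)).2 fun t => ?_
    rw [hst, Complex.norm_real, Real.norm_of_nonneg (hf0 t j).1]
    exact (hf0 t j).2
  have hss : Summable s := Summable.of_norm_bounded hgeom.summable hsn
  have hDt : ∀ t, (∑' j, s j) t = ((∑' j, f t j : ℝ) : ℂ) := by
    intro t
    rw [← ContinuousMap.tsum_apply hss, Complex.ofReal_tsum]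
    exact tsum_congr fun j => hst j t
  have hDA : ∑' j, s j ∈ A := by
    refine hA.mem_of_tendsto hss.hasSum (Filter.Eventually.of_forall fun F => ?_)
    exact A.sum_mem fun j _ => A.smul_mem (A.sub_mem A.one_mem (e j).2.1) _
  have hd0 : ∀ t, 0 ≤ ∑' j, f t j := fun t => tsum_nonneg fun j => (hf0 t j).1
  have hd1 : ∀ t, ∑' j, f t j ≤ 1 := fun t =>
    ((hfs t).tsum_le_tsum (fun j => (hf0 t j).2) hgeom.summable).trans hgeom.tsum_eq.le
  have hGt : ∀ t, (1 - ∑' j, s j) t = ((1 - ∑' j, f t j : ℝ) : ℂ) := by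
    intro t
    rw [ContinuousMap.sub_apply, hDt]
    simp
  obtain ⟨r, hr, hcon'⟩ := hcon (1 - ∑' j, s j) (A.sub_mem A.one_mem hDA) fun t => by
    rw [hGt, Complex.norm_real, Real.norm_of_nonneg (sub_nonneg.2 (hd1 t))]
    rcases (hd0 t).eq_or_lt with h | h
    · right
      rw [← h]
      simp
    · left
      linarith
  -- Where `e k = 1` and `e (k + 1) = 0`, the first nonzero term of the sum has index `k + 1`, so
  -- the sum is positive but at most `2 ^ -k`.
  obtain ⟨k, hk⟩ := exists_pow_lt_of_lt_one hr (by norm_num : (1 / 2 : ℝ) < 1)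
  obtain ⟨t, ht1, ht0⟩ := hlt k
  have hnorm : ‖1 - (1 - ∑' j, s j) t‖ = ∑' j, f t j := by
    rw [hGt, ← Complex.ofReal_one, ← Complex.ofReal_sub, sub_sub_cancel, Complex.norm_real,
      Real.norm_of_nonneg (hd0 t)]
  have hpos : 0 < ∑' j, f t j := by
    refine (hfs t).tsum_pos (fun j => (hf0 t j).1) (k + 1) ?_
    simp [hf, ht0]
  have hlt' : ∑' j, f t j < r := by
    have hzero : ∀ j ∈ Finset.range k, f t j = 0 := fun j hj => by
      simp [hf, hmono t j k (Finset.mem_range.1 hj).le ht1]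
    rw [← (hfs t).sum_add_tsum_nat_add k, Finset.sum_eq_zero hzero, zero_add]
    calc ∑' j, f t (j + k) ≤ ∑' j : ℕ, (1 / 2 : ℝ) ^ k * (1 / 2) ^ (j + 1) := by
          refine ((summable_nat_add_iff k).2 (hfs t)).tsum_le_tsum (fun j => ?_)
            (hgeom.summable.mul_left _)
          refine (hf0 t (j + k)).2.trans_eq ?_
          rw [← pow_add]
          congr 1
          ring
      _ = (1 / 2) ^ k := by rw [tsum_mul_left, hgeom.tsum_eq, mul_one]
      _ < r := hk
  have := hcon' t (hnorm ▸ hpos)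
  rw [hnorm] at this
  linarith

end Peak

/-! ### Assembling the perturbations -/

theorem stepAverage_apply {K : Type v} [TopologicalSpace K] (q : ℕ → C(K, ℂ)) (N k : ℕ) (t : K) :
    stepAverage q N k t = stepAverage (fun j => q j t) N k := by
  simp [stepAverage]

theorem stepAverage_mem {V : Type*} [AddCommGroup V] [Module ℂ V] {A : Submodule ℂ V} {q : ℕ → V}
    (hq : ∀ j, q j ∈ A) (N k : ℕ) : stepAverage q N k ∈ A :=
  A.smul_mem _ (A.sum_mem fun _ _ => A.sub_mem (hq _) (hq _))

section

variable {K : Type v} [TopologicalSpace K] [CompactSpace K] {X : Type u} [NormedAddCommGroup X]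
  [NormedSpace ℂ X] {τ : CompatibleTopology X}

/-- A function space over a uniform algebra contains a function bounded away from zero. -/
theorem IsFunctionSpaceOver.exists_le_norm_apply {S : Submodule ℂ (TauContinuousMap K τ)}
    {A : Subalgebra ℂ C(K, ℂ)} (hS : IsFunctionSpaceOver S A) :
    ∃ f ∈ S, ∃ c > 0, ∀ t, c ≤ ‖τ.toNormed (f t)‖ := by
  -- The constant 1 belongs to the base algebra, so `y ∘ f = 1` for some `f ∈ S`, and boundedness of
  -- `y` keeps `f` away from zero.
  obtain ⟨f, hf, y, hy⟩ := hS.base_eq.subset A.one_mem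
  obtain ⟨C, hC, hyC⟩ := τ.exists_norm_le y
  refine ⟨f, hf, C⁻¹, inv_pos.2 hC, fun t => ?_⟩
  have h1 : y (f t) = 1 := (DFunLike.congr_fun hy t).symm
  have h2 := hyC (f t)
  rw [h1, norm_one] at h2
  rwa [inv_le_iff_one_le_mul₀' hC]

namespace TauContinuousMap

/-- Pointwise the function is `ψ h + (1 - ψ) x`, almost a convex combination when `C` is near 1. -/
theorem norm_add_mulScalar_sub_le {ψ : C(K, ℂ)} {C : ℝ} (hC : 0 ≤ C)
    (hψ : ∀ t, ‖ψ t‖ + ‖1 - ψ t‖ ≤ C) {x h : TauContinuousMap K τ} (hx : ‖x‖ ≤ 1) (hh : ‖h‖ ≤ 1) :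
    ‖x + (h - x).mulScalar ψ‖ ≤ C := by
  refine norm_le_of_forall hC fun t => ?_
  rw [toNormed_add_apply, toNormed_mulScalar_apply, toNormed_sub_apply]
  have h1 := (norm_apply_le x t).trans hx
  have h2 := (norm_apply_le h t).trans hh
  calc _ = ‖ψ t • τ.toNormed (h t) + (1 - ψ t) • τ.toNormed (x t)‖ := by
        congr 1
        module
    _ ≤ ‖ψ t‖ * ‖τ.toNormed (h t)‖ + ‖1 - ψ t‖ * ‖τ.toNormed (x t)‖ := by
        rw [← norm_smul, ← norm_smul]
        exact norm_add_le _ _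
    _ ≤ ‖ψ t‖ * 1 + ‖1 - ψ t‖ * 1 := by gcongr
    _ ≤ C := by simpa using hψ t

theorem two_mul_norm_le_norm_mulScalar_sub {ψ : C(K, ℂ)} (x h : TauContinuousMap K τ) (t : K) :
    2 * (‖ψ t‖ * ‖τ.toNormed (h t)‖) ≤ ‖(h - x).mulScalar ψ - (-h - x).mulScalar ψ‖ := by
  refine le_trans (le_of_eq ?_) (norm_apply_le _ t)
  rw [toNormed_sub_apply, toNormed_mulScalar_apply, toNormed_mulScalar_apply, toNormed_sub_apply,
    toNormed_sub_apply, show τ.toNormed ((-h) t) = -τ.toNormed (h t) from rfl, ← norm_smul,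
    ← Complex.norm_two, ← norm_smul]
  congr 1
  module

end TauContinuousMap

open TauContinuousMap in
theorem IsFunctionSpaceOver.hasDiameterTwoProperty {S : Submodule ℂ (TauContinuousMap K τ)}
    {A : Subalgebra ℂ C(K, ℂ)} (hS : IsFunctionSpaceOver S A) (hA : ¬ FiniteDimensional ℂ A) :
    HasDiameterTwoProperty S := by
  obtain ⟨f, hfS, c, hc, hcf⟩ := hS.exists_le_norm_apply
  obtain ⟨G, hGA, hG, hacc⟩ := exists_isPeaking_not_isolated hS.isUniformAlgebra.isClosed hA
  have hK : Nonempty K := ⟨(hacc 1 one_pos).choose⟩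
  have hM : 0 < ‖f‖ := hc.trans_le ((hcf hK.some).trans (norm_apply_le f _))
  refine HasDiameterTwoProperty.of_weaklyNull fun x hx ε hε hε1 => ?_
  have hε1' : 0 < 1 - ε := by linarith
  obtain ⟨N, hN⟩ := exists_nat_gt (8 / ε)
  have hN0 : (0 : ℝ) < N := (by positivity : 0 < 8 / ε).trans hN
  have hN4 : 4 / (N : ℝ) ≤ ε / 2 := by
    rw [div_lt_iff₀ hε] at hN
    rw [div_le_iff₀ hN0]
    linarith
  -- The first bound gives `4 * η₀ + 4 / N ≤ ε`; the second makes `2 * η₀ * ‖f‖` smaller than `(1 -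
  -- ε) * c / 2`.
  obtain ⟨η₀, hη₀, hη₀1, hη₀2⟩ : ∃ η₀ > 0, η₀ ≤ ε / 8 ∧ η₀ ≤ (1 - ε) * c / (8 * ‖f‖) :=
    ⟨min (ε / 8) ((1 - ε) * c / (8 * ‖f‖)), lt_min (by positivity) (by positivity),
      min_le_left _ _, min_le_right _ _⟩
  rw [le_div_iff₀ (by positivity)] at hη₀2
  set η : ℕ → ℝ := fun j => η₀ * (1 / 2) ^ j with hη
  have hηpos : ∀ j, 0 < η j := fun j => by positivity
  have hηle : ∀ j, η j ≤ η₀ := fun j =>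
    mul_le_of_le_one_right hη₀.le (pow_le_one₀ (by norm_num) (by norm_num))
  have hηanti : Antitone η := fun i j hij =>
    mul_le_mul_of_nonneg_left (pow_le_pow_of_le_one (by norm_num) (by norm_num) hij) hη₀.le
  have hηsum : ∀ n, ∑ k ∈ Finset.range n, η k ≤ η₀ * 2 := fun n => by
    rw [← (hasSum_geometric_two.mul_left η₀).tsum_eq]
    exact (hasSum_geometric_two.mul_left η₀).summable.sum_le_tsum _ fun j _ => (hηpos j).le
  obtain ⟨n, hlevel, hjump⟩ := hG.exists_steps hacc hηpos
  have ha : ∀ t j, ‖G t ^ n j‖ ≤ 1 := fun t j => by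
    rw [norm_pow]
    exact pow_le_one₀ (norm_nonneg _) (hG.norm_le_one t)
  set q : ℕ → C(K, ℂ) := fun j => G ^ n j with hq
  have hqA : ∀ j, q j ∈ A := fun j => A.pow_mem hGA _
  set ψ : ℕ → C(K, ℂ) := stepAverage q N with hψ
  have hψA : ∀ k, ψ k ∈ A := stepAverage_mem (A := A.toSubmodule) hqA N
  have hψt : ∀ k t, ψ k t = stepAverage (fun j => G t ^ n j) N k := fun k t =>
    stepAverage_apply q N k t
  have hN0' : 0 < N := by exact_mod_cast hN0
  have hψ1 : ∀ k t, ‖ψ k t‖ + ‖1 - ψ k t‖ ≤ 1 + ε := by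
    intro k t
    obtain ⟨i, hi⟩ := hlevel t (k + 2 * N + 3)
    rw [hψt]
    refine (hi.norm_stepAverage_add_norm_one_sub_le (ha t) hηanti (fun j => (hηpos j).le) hN0'
      le_rfl).trans ?_
    linarith [hηle k]
  have hψsum : ∀ m t, ∑ k ∈ Finset.range m, ‖ψ k t‖ ≤ 2 * (η₀ * 2) + 2 * (2 * N + 3) := by
    intro m t
    obtain ⟨i, hi⟩ := hlevel t (m + 2 * N + 3)
    simp only [hψt]
    exact hi.sum_norm_stepAverage_le (ha t) hηanti (fun j => (hηpos j).le) hηsum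
  set p : ℕ → C(K, ℂ) := fun k => q (k + N) - q (k + N + 2) with hp
  have hpA : ∀ k, p k ∈ A := fun k => A.sub_mem (hqA _) (hqA _)
  set P : ℕ → TauContinuousMap K τ := fun k => f.mulScalar (p k) with hP
  have hPt : ∀ k t, ‖τ.toNormed (P k t)‖ = ‖p k t‖ * ‖τ.toNormed (f t)‖ := fun k t => by
    rw [hP, toNormed_mulScalar_apply, norm_smul]
  have hβ : ∀ k, c / 2 ≤ ‖P k‖ := by
    intro k
    -- At a point of level `k + N + 1`, strictly between the two indices of `p k`, the value `p k t`
    -- is near 1.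
    obtain ⟨t, ht⟩ := hjump (k + N + 1)
    have h1 : ‖1 - p k t‖ ≤ 2 * η k :=
      (ht (k + N + 3)).norm_one_sub_sub_le hηanti (j := k + N) (j' := k + N + 2) (by omega)
        (by omega) (by omega) (by omega) (by omega) (by omega)
    have h2 : 1 / 2 ≤ ‖p k t‖ := by
      have h3 : ‖(1 : ℂ)‖ ≤ ‖1 - p k t‖ + ‖p k t‖ := by
        simpa using norm_add_le (1 - p k t) (p k t)
      rw [norm_one] at h3
      linarith [hηle k]
    calc c / 2 = 1 / 2 * c := by ring
      _ ≤ ‖p k t‖ * ‖τ.toNormed (f t)‖ := by gcongr; exact hcf t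
      _ ≤ ‖P k‖ := (hPt k t).symm.trans_le (norm_apply_le _ t)
  have hβ0 : ∀ k, 0 < ‖P k‖ := fun k => (half_pos hc).trans_le (hβ k)
  have hbig : ∀ k, ∃ t, (1 - ε) * ‖P k‖ < ‖τ.toNormed (P k t)‖ ∧ 1 - ε ≤ ‖ψ k t‖ := by
    intro k
    obtain ⟨t, ht⟩ := exists_lt_norm_apply (P k) (mul_lt_of_lt_one_left (hβ0 k)
      (by linarith : 1 - ε < 1))
    refine ⟨t, ht, ?_⟩
    obtain ⟨i, hi⟩ := hlevel t (k + 2 * N + 3)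
    -- At any other level `p k t` is small, and `P k` could not nearly attain its norm at `t`.
    have hmid : k + N ≤ i ∧ i ≤ k + N + 2 := by
      by_contra hout
      have h1 : ‖p k t‖ ≤ 2 * η k :=
        hi.norm_sub_le hηanti (j := k + N) (j' := k + N + 2) (by omega) (by omega) (by omega)
          (by omega) (by omega)
      have h2 : ‖τ.toNormed (P k t)‖ ≤ 2 * η₀ * ‖f‖ := by
        rw [hPt]
        exact mul_le_mul (h1.trans (by linarith [hηle k])) (norm_apply_le f t) (norm_nonneg _)
          (by positivity)
      have h3 : (1 - ε) * (c / 2) ≤ (1 - ε) * ‖P k‖ := by gcongr; exact hβ k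
      have h4 : 0 < (1 - ε) * c := by positivity
      linarith
    have h1 := hi.norm_one_sub_stepAverage_le hηanti (fun j => (hηpos j).le) hN0' le_rfl hmid.1 hmid.2
    rw [← hψt] at h1
    have h3 : ‖(1 : ℂ)‖ ≤ ‖1 - ψ k t‖ + ‖ψ k t‖ := by
      simpa using norm_add_le (1 - ψ k t) (ψ k t)
    rw [norm_one] at h3
    linarith [hηle k]
  set h : ℕ → TauContinuousMap K τ := fun k => ((‖P k‖⁻¹ : ℝ) : ℂ) • P k with hh
  have hhS : ∀ k, h k ∈ S := fun k => S.smul_mem _ (hS.mul_mem _ (hpA k) f hfS)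
  have hscal : ∀ k, ‖((‖P k‖⁻¹ : ℝ) : ℂ)‖ = ‖P k‖⁻¹ := fun k => by
    rw [Complex.norm_real, Real.norm_of_nonneg (inv_nonneg.2 (norm_nonneg _))]
  have hh1 : ∀ k, ‖h k‖ ≤ 1 := fun k => by
    rw [hh, norm_smul, hscal, inv_mul_cancel₀ (hβ0 k).ne']
  have hx' : ‖(x : TauContinuousMap K τ)‖ ≤ 1 := hx
  have hnull : ∀ g : ℕ → TauContinuousMap K τ, (∀ k, ‖g k‖ ≤ 1) →
      ∀ k, ‖g k - x‖ ≤ 2 := fun g hg k => (norm_sub_le _ _).trans (by linarith [hg k])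
  have hneg : ∀ k, ‖-h k‖ ≤ 1 := fun k => (norm_neg (h k)).trans_le (hh1 k)
  refine ⟨fun k => ⟨(h k - x).mulScalar (ψ k), hS.mul_mem _ (hψA k) _ (S.sub_mem (hhS k) x.2)⟩,
    fun k => ⟨(-h k - x).mulScalar (ψ k),
      hS.mul_mem _ (hψA k) _ (S.sub_mem (S.neg_mem (hhS k)) x.2)⟩,
    weaklyNull_mulScalar hψsum (hnull h hh1) fun _ => rfl,
    weaklyNull_mulScalar hψsum (hnull _ hneg) fun _ => rfl, fun k => ⟨?_, ?_, ?_⟩⟩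
  · exact norm_add_mulScalar_sub_le (by linarith) (hψ1 k) hx' (hh1 k)
  · exact norm_add_mulScalar_sub_le (by linarith) (hψ1 k) hx' (hneg k)
  · obtain ⟨t, ht1, ht2⟩ := hbig k
    refine le_trans ?_ (two_mul_norm_le_norm_mulScalar_sub (x : TauContinuousMap K τ) (h k) t)
    -- One factor `1 - ε` comes from `h k`, the other from `ψ k`.
    have h1 : 1 - ε ≤ ‖τ.toNormed (h k t)‖ := by
      rw [hh, toNormed_smul_apply, norm_smul, hscal, le_inv_mul_iff₀ (hβ0 k), mul_comm]
      exact ht1.le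
    rw [sq]
    gcongr

end

theorem mainTheorem1 {K : Type v} [TopologicalSpace K] [CompactSpace K] [T2Space K]
    {X : Type u} [NormedAddCommGroup X] [NormedSpace ℂ X] [CompleteSpace X]
    (τ : CompatibleTopology X)
    (S : Submodule ℂ (TauContinuousMap K τ)) (A : Subalgebra ℂ C(K, ℂ))
    (hS : IsFunctionSpaceOver S A) (hA : ¬ FiniteDimensional ℂ A) :
    HasDiameterTwoProperty S :=
  hS.hasDiameterTwoProperty hA
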